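/- Let $A=(a_{ijk})$ be a real $n_1\times n_2\times n_3$ tensor. The Frobenius inner product is $\langle A,B\rangle_F=\sum_{i,j,k}a_{ijk}b_{ijk}$, and a tensor is of rank one if it is nonzero and of the form $x\otimes y\otimes z=(x_iy_jz_k)_{ijk}$ with $x\in\mathbb{R}^{n_1}$, $y\in\mathbb{R}^{n_2}$, $z\in\mathbb{R}^{n_3}$. The orthogonal rank $\mathrm{rk}_\perp(A)$ is the smallest integer $r\ge 0$ such that $A=Y_1+\dots+Y_r$ for some rank-one tensors $Y_1,\dots,Y_r$ with $\langle Y_\ell,Y_{\ell'}\rangle_F=0$ for all $\ell\ne\ell'$ (so $\mathrm{rk}_\perp(0)=0$). Theorem. The maximal orthogonal rank of a real $3\times3\times3$ tensor is seven: $$\max_{A\in\mathbb{R}^{3}\otimes\mathbb{R}^{3}\otimes\mathbb{R}^{3}}\mathrm{rk}_\perp(A)=7,$$ that is, every real $3\times 3\times 3$ tensor has orthogonal rank at most $7$, and some real $3\times 3\times 3$ tensor has orthogonal rank exactly $7$. -/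

import Mathlib

namespace OrthRank

/-- Real tensors of order three and size `n₁ × n₂ × n₃`, as tables of real numbers. -/
abbrev Tensor (n₁ n₂ n₃ : ℕ) : Type := Fin n₁ → Fin n₂ → Fin n₃ → ℝ

/-- The Frobenius inner product. -/
def frobeniusInner {n₁ n₂ n₃ : ℕ} (A B : Tensor n₁ n₂ n₃) : ℝ :=
  ∑ i, ∑ j, ∑ k, A i j k * B i j k

/-- The outer product `x ⊗ y ⊗ z` of three vectors. -/
def outer {n₁ n₂ n₃ : ℕ} (x : Fin n₁ → ℝ) (y : Fin n₂ → ℝ) (z : Fin n₃ → ℝ) :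
    Tensor n₁ n₂ n₃ :=
  fun i j k => x i * y j * z k

/-- A tensor has rank one if it is nonzero and an outer product of vectors. -/
def IsRankOne {n₁ n₂ n₃ : ℕ} (Y : Tensor n₁ n₂ n₃) : Prop :=
  Y ≠ 0 ∧ ∃ x y z, Y = outer x y z

/-- `A` is a sum of exactly `r` pairwise Frobenius-orthogonal rank-one tensors. -/
def HasOrthogonalDecomposition {n₁ n₂ n₃ : ℕ} (A : Tensor n₁ n₂ n₃) (r : ℕ) : Prop :=
  ∃ Y : Fin r → Tensor n₁ n₂ n₃,
    (∀ l, IsRankOne (Y l)) ∧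
    (∀ l l', l ≠ l' → frobeniusInner (Y l) (Y l') = 0) ∧
    A = ∑ l, Y l

/-- The orthogonal rank of `A`: the smallest `r` such that `A` is a sum of `r` pairwise
orthogonal rank-one tensors. The value is taken in `ℕ∞`, so that it would be `⊤`, and not a
natural number, for a tensor without any such decomposition. -/
noncomputable def orthogonalRank {n₁ n₂ n₃ : ℕ} (A : Tensor n₁ n₂ n₃) : ℕ∞ :=
  ⨅ (r : ℕ) (_ : HasOrthogonalDecomposition A r), (r : ℕ∞)

end OrthRank

namespace OrthRank

variable {n₁ n₂ n₃ : ℕ}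

/-! Upper bound (`orthogonalRank_le_seven`): the determinant of the slice `contract A z` is an odd
continuous function of `z`, so it vanishes at two orthonormal vectors. Completing these to a basis
of the third mode gives slices of rank at most 2, 2 and 3, each split orthogonally: 2 + 2 + 3 = 7.
Lower bound (`le_orthogonalRank`): a tensor of spectral norm at most 1 has only terms of norm at
most 1 in an orthogonal decomposition. `quaternionTensor` has squared norm 7, and its spectral norm
is at most 1 because the quaternion norm is multiplicative. -/

theorem frobeniusInner_outer_outer (x x' : Fin n₁ → ℝ) (y y' : Fin n₂ → ℝ) (z z' : Fin n₃ → ℝ) :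
    frobeniusInner (outer x y z) (outer x' y' z') =
      (∑ i, x i * x' i) * (∑ j, y j * y' j) * ∑ k, z k * z' k := by
  rw [Finset.sum_mul_sum, Finset.sum_mul]
  refine Finset.sum_congr rfl fun i _ => ?_
  rw [Finset.sum_mul]
  refine Finset.sum_congr rfl fun j _ => ?_
  rw [Finset.mul_sum]
  refine Finset.sum_congr rfl fun k _ => ?_
  simp only [outer]
  ring

theorem frobeniusInner_comm (A B : Tensor n₁ n₂ n₃) :
    frobeniusInner A B = frobeniusInner B A := by
  simp only [frobeniusInner, mul_comm]

theorem frobeniusInner_sum_left {ι : Type*} [Fintype ι] (Y : ι → Tensor n₁ n₂ n₃)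
    (B : Tensor n₁ n₂ n₃) :
    frobeniusInner (∑ l, Y l) B = ∑ l, frobeniusInner (Y l) B := by
  simp only [frobeniusInner, Finset.sum_apply, Finset.sum_mul]
  symm
  rw [Finset.sum_comm]
  refine Finset.sum_congr rfl fun i _ => ?_
  rw [Finset.sum_comm]
  refine Finset.sum_congr rfl fun j _ => ?_
  rw [Finset.sum_comm]

/-- Orthogonal rank is at most the number of nonzero terms in an orthogonal decomposition. -/
theorem orthogonalRank_le_of_sum_outer {ι : Type*} [Fintype ι] {A : Tensor n₁ n₂ n₃}
    (x : ι → Fin n₁ → ℝ) (y : ι → Fin n₂ → ℝ) (z : ι → Fin n₃ → ℝ)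
    (hA : A = ∑ l, outer (x l) (y l) (z l))
    (ho : ∀ l l', l ≠ l' →
      frobeniusInner (outer (x l) (y l) (z l)) (outer (x l') (y l') (z l')) = 0)
    (s : Finset ι) (hs : ∀ l ∉ s, outer (x l) (y l) (z l) = 0) :
    orthogonalRank A ≤ s.card := by
  classical
  set Y : ι → Tensor n₁ n₂ n₃ := fun l => outer (x l) (y l) (z l) with hY
  set t : Finset ι := Finset.univ.filter fun l => Y l ≠ 0 with ht
  have hts : t ⊆ s := by
    intro l hl
    by_contra h
    exact (Finset.mem_filter.1 hl).2 (hs l h)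
  have hdec : HasOrthogonalDecomposition A t.card := by
    refine ⟨fun i => Y (t.equivFin.symm i), fun i => ⟨?_, _, _, _, rfl⟩, fun i j hij => ?_, ?_⟩
    · exact (Finset.mem_filter.1 (t.equivFin.symm i).2).2
    · exact ho _ _ fun h => hij (t.equivFin.symm.injective (Subtype.ext h))
    · rw [Equiv.sum_comp t.equivFin.symm (fun l : t => Y l), Finset.sum_coe_sort t Y, hA, ht,
        Finset.sum_filter_ne_zero]
  exact (iInf₂_le t.card hdec).trans (by exact_mod_cast Finset.card_le_card hts)

/-- If `f(x, y, z) ≤ ‖x‖ ‖y‖ ‖z‖` for the trilinear form of `A`, then the orthogonal rank of `A`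
is at least `‖A‖²`. -/
theorem le_orthogonalRank {A : Tensor n₁ n₂ n₃}
    (h : ∀ x y z, frobeniusInner A (outer x y z) ^ 2 ≤
      frobeniusInner (outer x y z) (outer x y z)) {m : ℕ} (hm : frobeniusInner A A = m) :
    (m : ℕ∞) ≤ orthogonalRank A := by
  refine le_iInf₂ fun r hr => ?_
  obtain ⟨Y, hY, ho, hA⟩ := hr
  have hself : ∀ l, frobeniusInner A (Y l) = frobeniusInner (Y l) (Y l) := by
    intro l
    rw [hA, frobeniusInner_sum_left, Finset.sum_eq_single l (fun l' _ hl => ho l' l hl) (by simp)]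
  have hle : ∀ l, frobeniusInner (Y l) (Y l) ≤ 1 := by
    intro l
    obtain ⟨x, y, z, hl⟩ := (hY l).2
    have := h x y z
    rw [← hl, hself] at this
    -- With `t` the squared norm of `Y l`, this reads `t ^ 2 ≤ t`.
    nlinarith
  have hsum : frobeniusInner A A = ∑ l, frobeniusInner (Y l) (Y l) := by
    conv_lhs => rw [hA, frobeniusInner_sum_left, ← hA]
    exact Finset.sum_congr rfl fun l _ => by rw [frobeniusInner_comm, hself]
  have hmr : (m : ℝ) ≤ r := by
    rw [← hm, hsum]
    exact (Finset.sum_le_sum fun l _ => hle l).trans (by simp)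
  exact_mod_cast hmr

/-- The table of the quaternion product restricted to the span of `1, i, j` and projected onto
this span. -/
def quaternionTensor : Tensor 3 3 3 :=
  ![![![1, 0, 0], ![0, 1, 0], ![0, 0, 1]],
    ![![0, 1, 0], ![-1, 0, 0], ![0, 0, 0]],
    ![![0, 0, 1], ![0, 0, 0], ![-1, 0, 0]]]

theorem seven_le_orthogonalRank_quaternionTensor : 7 ≤ orthogonalRank quaternionTensor := by
  refine le_orthogonalRank (m := 7) (fun x y z => ?_) ?_
  · rw [frobeniusInner_outer_outer]
    simp only [frobeniusInner, outer, quaternionTensor, Fin.sum_univ_three, Matrix.cons_val]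
    set a := x 0 * y 0 - x 1 * y 1 - x 2 * y 2 with ha
    set b := x 0 * y 1 + x 1 * y 0 with hb
    set c := x 0 * y 2 + x 2 * y 0 with hc
    have h : (a * z 0 + b * z 1 + c * z 2) ^ 2 ≤
        (a ^ 2 + b ^ 2 + c ^ 2) * (z 0 ^ 2 + z 1 ^ 2 + z 2 ^ 2) := by
      nlinarith [sq_nonneg (a * z 1 - b * z 0), sq_nonneg (a * z 2 - c * z 0),
        sq_nonneg (b * z 2 - c * z 1)]
    -- The added square is the `k`-component lost in the projection. With it, the first factor
    -- equals `‖x‖² ‖y‖²`.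
    have h' : (a ^ 2 + b ^ 2 + c ^ 2) * (z 0 ^ 2 + z 1 ^ 2 + z 2 ^ 2) ≤
        (a ^ 2 + b ^ 2 + c ^ 2 + (x 1 * y 2 - x 2 * y 1) ^ 2) *
          (z 0 ^ 2 + z 1 ^ 2 + z 2 ^ 2) :=
      mul_le_mul_of_nonneg_right (by linarith [sq_nonneg (x 1 * y 2 - x 2 * y 1)])
        (by positivity)
    have h'' := h.trans h'
    rw [ha, hb, hc] at h''
    linarith
  · simp only [frobeniusInner, quaternionTensor, Fin.sum_univ_three, Matrix.cons_val]
    norm_num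

/-- Every unit vector is the first row of an orthogonal matrix. -/
theorem exists_orthogonal_matrix_row {w : Fin 3 → ℝ} (hw : ∑ i, w i * w i = 1) :
    ∃ P : Matrix (Fin 3) (Fin 3) ℝ, P * P.transpose = 1 ∧ P 0 = w := by
  have hv : Orthonormal ℝ (({0} : Set (Fin 3)).domRestrict
      fun _ : Fin 3 => (WithLp.toLp 2 w : EuclideanSpace ℝ (Fin 3))) := by
    refine ⟨fun i => ?_, fun i j hij => (hij (Subsingleton.elim i j)).elim⟩
    simp [EuclideanSpace.norm_eq, Set.domRestrict, pow_two, hw]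
  obtain ⟨b, hb⟩ := hv.exists_orthonormalBasis_extension_of_card_eq (by simp)
  refine ⟨Matrix.of fun a i => b a i, ?_, ?_⟩
  · ext a c
    have := b.inner_eq_ite c a
    simp only [PiLp.inner_apply, RCLike.inner_apply, conj_trivial] at this
    simp [Matrix.mul_apply, this, Matrix.one_apply, eq_comm]
  · ext i
    simp [hb 0 rfl]

/-- An odd continuous function vanishes somewhere on every circle centred at the origin. -/
theorem exists_circle_zero {g : (Fin 3 → ℝ) → ℝ} (hg : Continuous g) (hodd : ∀ z, g (-z) = -g z)
    (u v : Fin 3 → ℝ) : ∃ θ : ℝ, g (Real.cos θ • u + Real.sin θ • v) = 0 := by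
  set f : ℝ → ℝ := fun θ => g (Real.cos θ • u + Real.sin θ • v) with hf
  have hc : Continuous f := by fun_prop
  have hpi : f Real.pi = -f 0 := by simp [hf, hodd]
  rcases le_total (f 0) 0 with h | h
  · exact mem_range_of_exists_le_of_exists_ge hc ⟨0, h⟩ ⟨Real.pi, by linarith⟩
  · exact mem_range_of_exists_le_of_exists_ge hc ⟨Real.pi, by linarith⟩ ⟨0, h⟩

/-- An odd continuous function vanishes at two orthogonal unit vectors. -/
theorem exists_orthogonal_zeros {g : (Fin 3 → ℝ) → ℝ} (hg : Continuous g)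
    (hodd : ∀ z, g (-z) = -g z) :
    ∃ Z : Matrix (Fin 3) (Fin 3) ℝ, Z * Z.transpose = 1 ∧ g (Z 0) = 0 ∧ g (Z 1) = 0 := by
  obtain ⟨θ, hθ⟩ := exists_circle_zero hg hodd ![1, 0, 0] ![0, 1, 0]
  -- This great circle is orthogonal to the first zero.
  obtain ⟨φ, hφ⟩ := exists_circle_zero hg hodd ![-Real.sin θ, Real.cos θ, 0] ![0, 0, 1]
  refine ⟨!![Real.cos θ, Real.sin θ, 0;
    -(Real.cos φ * Real.sin θ), Real.cos φ * Real.cos θ, Real.sin φ;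
    Real.sin φ * Real.sin θ, -(Real.sin φ * Real.cos θ), Real.cos φ], ?_, ?_, ?_⟩
  · have h₁ := Real.sin_sq_add_cos_sq θ
    have h₂ := Real.sin_sq_add_cos_sq φ
    ext i j
    fin_cases i <;> fin_cases j <;>
      simp [Matrix.mul_apply, Fin.sum_univ_three] <;> grind
  · convert hθ using 2
    ext i
    fin_cases i <;> simp
  · convert hφ using 2
    ext i
    fin_cases i <;> simp

/-- The contraction of the third mode of a tensor with a vector. -/
def contract (A : Tensor 3 3 3) (z : Fin 3 → ℝ) : Matrix (Fin 3) (Fin 3) ℝ :=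
  Matrix.of fun i j => ∑ k, z k * A i j k

theorem continuous_det_contract (A : Tensor 3 3 3) : Continuous fun z => (contract A z).det := by
  refine Continuous.matrix_det (continuous_matrix fun i j => ?_)
  simp only [contract, Matrix.of_apply]
  fun_prop

theorem det_contract_neg (A : Tensor 3 3 3) (z : Fin 3 → ℝ) :
    (contract A (-z)).det = -(contract A z).det := by
  have : contract A (-z) = -contract A z := by
    ext i j
    simp [contract]
  rw [this, Matrix.det_neg]
  norm_num

/-- A singular matrix has a left null vector that is the first row of an orthogonal matrix. -/
theorem exists_orthogonal_matrix_vecMul_eq_zero {B : Matrix (Fin 3) (Fin 3) ℝ} (hB : B.det = 0) :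
    ∃ P : Matrix (Fin 3) (Fin 3) ℝ, P * P.transpose = 1 ∧ Matrix.vecMul (P 0) B = 0 := by
  obtain ⟨w, hw, hwB⟩ := Matrix.exists_vecMul_eq_zero_iff.2 hB
  have hpos : 0 < ∑ i, w i * w i :=
    (Finset.sum_nonneg fun i _ => mul_self_nonneg (w i)).lt_of_ne'
      (fun h => hw (dotProduct_self_eq_zero.1 h))
  set c := (Real.sqrt (∑ i, w i * w i))⁻¹ with hc
  have hunit : ∑ i, (c • w) i * (c • w) i = 1 := by
    have : ∑ i, (c • w) i * (c • w) i = c * c * ∑ i, w i * w i := by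
      rw [Finset.mul_sum]
      exact Finset.sum_congr rfl fun i _ => by simp only [Pi.smul_apply, smul_eq_mul]; ring
    rw [this, hc, ← mul_inv, Real.mul_self_sqrt hpos.le, inv_mul_cancel₀ hpos.ne']
  obtain ⟨P, hP, hP0⟩ := exists_orthogonal_matrix_row hunit
  exact ⟨P, hP, by rw [hP0, Matrix.smul_vecMul, hwB, smul_zero]⟩

theorem sum_row_mul_row {P : Matrix (Fin 3) (Fin 3) ℝ} (hP : P * P.transpose = 1) {a b : Fin 3}
    (hab : a ≠ b) : ∑ i, P a i * P b i = 0 := by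
  have := congrFun (congrFun hP a) b
  simpa [Matrix.mul_apply, Matrix.one_apply, hab] using this

/-- Expand the third mode in the rows of `Z`, then the first mode of each slice in a basis `P a` of
its own. -/
theorem eq_sum_outer (A : Tensor 3 3 3) {Z : Matrix (Fin 3) (Fin 3) ℝ} (hZ : Z * Z.transpose = 1)
    {P : Fin 3 → Matrix (Fin 3) (Fin 3) ℝ} (hP : ∀ a, P a * (P a).transpose = 1) :
    A = ∑ l : Fin 3 × Fin 3,
      outer (P l.1 l.2) (Matrix.vecMul (P l.1 l.2) (contract A (Z l.1))) (Z l.1) := by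
  have hslice : ∀ a i j, ∑ b, P a b i * Matrix.vecMul (P a b) (contract A (Z a)) j =
      contract A (Z a) i j := by
    intro a i j
    have h : (P a).transpose * (P a * contract A (Z a)) = contract A (Z a) := by
      rw [← Matrix.mul_assoc, mul_eq_one_comm.1 (hP a), Matrix.one_mul]
    have := congrFun (congrFun h i) j
    simpa [Matrix.mul_apply, Matrix.vecMul, dotProduct] using this
  funext i j k
  have hk : ∑ a, contract A (Z a) i j * Z a k = A i j k := by
    have h : Matrix.mulVec (Z.transpose * Z) (A i j) = A i j := by
      rw [mul_eq_one_comm.1 hZ, Matrix.one_mulVec]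
    have := congrFun h k
    rw [← Matrix.mulVec_mulVec] at this
    simpa [Matrix.mulVec, dotProduct, contract, mul_comm] using this
  simp only [Finset.sum_apply, outer, Fintype.sum_prod_type]
  rw [← hk]
  exact Finset.sum_congr rfl fun a _ => by rw [← hslice, Finset.sum_mul]

theorem orthogonalRank_le_seven (A : Tensor 3 3 3) : orthogonalRank A ≤ 7 := by
  obtain ⟨Z, hZ, h₀, h₁⟩ :=
    exists_orthogonal_zeros (continuous_det_contract A) (det_contract_neg A)
  obtain ⟨P₀, hP₀, hz₀⟩ := exists_orthogonal_matrix_vecMul_eq_zero h₀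
  obtain ⟨P₁, hP₁, hz₁⟩ := exists_orthogonal_matrix_vecMul_eq_zero h₁
  let P : Fin 3 → Matrix (Fin 3) (Fin 3) ℝ := ![P₀, P₁, 1]
  have hP : ∀ a, P a * (P a).transpose = 1 := by
    intro a
    fin_cases a <;> simp [P, hP₀, hP₁]
  refine orthogonalRank_le_of_sum_outer _ _ _ (eq_sum_outer A hZ hP) ?_
    ({(0, 0), (1, 0)}ᶜ : Finset (Fin 3 × Fin 3)) ?_
  · rintro ⟨a, b⟩ ⟨a', b'⟩ hne
    rw [frobeniusInner_outer_outer]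
    -- Terms of one slice are orthogonal in the first factor, terms of different slices in the
    -- third.
    by_cases ha : a = a'
    · subst ha
      rw [sum_row_mul_row (hP a) (fun hb => hne (Prod.ext rfl hb)), zero_mul, zero_mul]
    · rw [sum_row_mul_row hZ ha, mul_zero]
  · intro l hl
    have hl : l = (0, 0) ∨ l = (1, 0) := by
      by_contra h
      exact hl (by simpa using h)
    rcases hl with rfl | rfl <;> funext i j k
    · simp [outer, P, hz₀]
    · simp [outer, P, hz₁]

end OrthRank

theorem mainTheorem2 :
    IsGreatest (Set.range fun A : OrthRank.Tensor 3 3 3 => OrthRank.orthogonalRank A) 7 := by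
  refine ⟨⟨OrthRank.quaternionTensor, le_antisymm (OrthRank.orthogonalRank_le_seven _)
    OrthRank.seven_le_orthogonalRank_quaternionTensor⟩, ?_⟩
  rintro _ ⟨A, rfl⟩
  exact OrthRank.orthogonalRank_le_seven A
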